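/- Let $A$ and $B$ be quantum systems of finite dimensions $N_A\le N_B$ with Hamiltonians (Hermitian operators) $H_A$ and $H_B$, and let $H=H_A\otimes 1+1\otimes H_B$ be the local Hamiltonian of the bipartite system $A$-$B$. The entropy of entanglement of a pure state (unit vector) $|\psi\rangle$ of $A$-$B$ is $\mathcal E(|\psi\rangle)=S(\mathrm{Tr}_B|\psi\rangle\langle\psi|)$, where $S(\sigma)=-\mathrm{Tr}(\sigma\ln\sigma)$. For $\varepsilon\in[0,\ln N_A]$ let $E_{\min}(\varepsilon)$ and $E_{\max}(\varepsilon)$ be the minimum and the maximum of $\langle\psi|H|\psi\rangle$ over all pure states $|\psi\rangle$ with $\mathcal E(|\psi\rangle)=\varepsilon$. Let $\mathcal E_m$ be any convex entanglement measure that equals the entropy of entanglement on pure states, that is, a function from the density matrices of $A$-$B$ to the nonnegative reals such that $\mathcal E_m\left(\sum_i p_i\rho_i\right)\le\sum_i p_i\,\mathcal E_m(\rho_i)$ for all finite families of density matrices $\rho_i$ and weights $p_i\ge 0$ with $\sum_i p_i=1$, and $\mathcal E_m(|\psi\rangle\langle\psi|)=\mathcal E(|\psi\rangle)$ for every pure state.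 Then for every density matrix (mixed state) $\rho$ of $A$-$B$ one has $\mathcal E_m(\rho)\in[0,\ln N_A]$, the minimum $E_{\min}(\mathcal E_m(\rho))$ and the maximum $E_{\max}(\mathcal E_m(\rho))$ are attained, and $$E_{\min}(\mathcal E_m(\rho))\;\le\;\mathrm{Tr}[H\rho]\;\le\;E_{\max}(\mathcal E_m(\rho)).$$ -/

import Mathlib

open scoped ComplexOrder

/-- Density matrices (states): positive semidefinite matrices of trace one. -/
def IsDensityMatrix {n : Type*} [Fintype n] (ρ : Matrix n n ℂ) : Prop :=
  ρ.PosSemidef ∧ ρ.trace = 1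

/-- The projector `|ψ⟩⟨ψ|`. -/
def ketBra {n : Type*} (ψ : EuclideanSpace ℂ n) : Matrix n n ℂ :=
  Matrix.vecMulVec (fun i => ψ i) (fun j => star (ψ j))

/-- The partial trace over the second factor, `Tr_B`. -/
def traceB {a b : Type*} [Fintype b] (ρ : Matrix (a × b) (a × b) ℂ) : Matrix a a ℂ :=
  Matrix.of fun i j => ∑ k, ρ (i, k) (j, k)

theorem traceB_ketBra_isHermitian {a b : Type*} [Fintype b]
    (ψ : EuclideanSpace ℂ (a × b)) : (traceB (ketBra ψ)).IsHermitian := by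
  ext i j
  simp [traceB, ketBra, Matrix.vecMulVec_apply, mul_comm]

/-- The von Neumann entropy `S(ρ) = -Tr(ρ ln ρ) = -∑ λᵢ ln λᵢ`, where the `λᵢ` are the
eigenvalues of `ρ` counted with multiplicity, and `0 ln 0 = 0`. -/
noncomputable def vonNeumannEntropy {n : Type*} [Fintype n] [DecidableEq n]
    (ρ : Matrix n n ℂ) (hρ : ρ.IsHermitian) : ℝ :=
  ∑ i, Real.negMulLog (hρ.eigenvalues i)

/-- The entropy of entanglement of a pure state: the von Neumann entropy of its reduced state
on the system `A`. -/
noncomputable def entanglementEntropy {a b : Type*} [Fintype a] [DecidableEq a] [Fintype b]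
    (ψ : EuclideanSpace ℂ (a × b)) : ℝ :=
  vonNeumannEntropy (traceB (ketBra ψ)) (traceB_ketBra_isHermitian ψ)

/-- The local Hamiltonian `H = H_A ⊗ 1 + 1 ⊗ H_B`. -/
def localHamiltonian {a b : Type*} [DecidableEq a] [DecidableEq b]
    (HA : Matrix a a ℂ) (HB : Matrix b b ℂ) : Matrix (a × b) (a × b) ℂ :=
  Matrix.kronecker HA (1 : Matrix b b ℂ) + Matrix.kronecker (1 : Matrix a a ℂ) HB

/-- The energy `Tr[Hρ]`, a real number when `H` and `ρ` are Hermitian. -/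
noncomputable def energy {n : Type*} [Fintype n] (H ρ : Matrix n n ℂ) : ℝ :=
  ((H * ρ).trace).re

/-- The set of energies of the pure states whose entropy of entanglement is `ε`. -/
def pureEnergies {a b : Type*} [Fintype a] [DecidableEq a] [Fintype b] [DecidableEq b]
    (HA : Matrix a a ℂ) (HB : Matrix b b ℂ) (ε : ℝ) : Set ℝ :=
  {x | ∃ ψ : EuclideanSpace ℂ (a × b), ‖ψ‖ = 1 ∧ entanglementEntropy ψ = ε ∧
    energy (localHamiltonian HA HB) (ketBra ψ) = x}

/-- `E_min(ε)`, the least energy of a pure state with entropy of entanglement `ε`. -/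
noncomputable def Emin {a b : Type*} [Fintype a] [DecidableEq a] [Fintype b] [DecidableEq b]
    (HA : Matrix a a ℂ) (HB : Matrix b b ℂ) (ε : ℝ) : ℝ :=
  sInf (pureEnergies HA HB ε)

/-- `E_max(ε)`, the greatest energy of a pure state with entropy of entanglement `ε`. -/
noncomputable def Emax {a b : Type*} [Fintype a] [DecidableEq a] [Fintype b] [DecidableEq b]
    (HA : Matrix a a ℂ) (HB : Matrix b b ℂ) (ε : ℝ) : ℝ :=
  sSup (pureEnergies HA HB ε)

/-- A convex entanglement measure on the states of the bipartite system that equals the entropy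
of entanglement on pure states. Only the values of `𝓔` at density matrices matter. -/
structure IsConvexEntanglementMeasure {a b : Type*} [Fintype a] [DecidableEq a] [Fintype b]
    (𝓔 : Matrix (a × b) (a × b) ℂ → ℝ) : Prop where
  nonneg : ∀ ρ, IsDensityMatrix ρ → 0 ≤ 𝓔 ρ
  convex : ConvexOn ℝ {ρ | IsDensityMatrix ρ} 𝓔
  pure_eq : ∀ ψ : EuclideanSpace ℂ (a × b), ‖ψ‖ = 1 → 𝓔 (ketBra ψ) = entanglementEntropy ψ

open Matrix

/-! Everything reduces to probability vectors `p` on the `NA` Schmidt levels, with entropy `∑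
negMulLog (p i)` and energy `∑ p i * e i`, where `e i` adds the `i`-th lowest levels of `HA` and
`HB`. The Schmidt weights of a pure state, sorted downwards, have its entropy and at most its
energy: both reduced states have these weights as spectrum up to zeros, and von Neumann's trace
inequality bounds each local energy (`exists_mem_stdSimplex_of_pureState`). Conversely every `p` is
realized exactly by a superposition of paired eigenvectors (`exists_pureState_of_mem_stdSimplex`).
For a mixed `ρ`, average the Schmidt vectors of its eigenvectors into `q`. Convexity of `𝓔` and
concavity of entropy give `𝓔 ρ ≤ S(q)`, and the energy of `q` is at most that of `ρ`. Sliding `q`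
towards the lowest level brings the entropy down to exactly `𝓔 ρ` without raising the energy
(`exists_entropy_eq_of_le`). Compactness of the simplex yields the minimum; replacing `H` by `-H`
yields the maximum. -/

/-! ### Spectra and the trace inequality -/

theorem Antitone.eq_of_map_univ_eq {n : ℕ} {f g : Fin n → ℝ} (hf : Antitone f) (hg : Antitone g)
    (h : Finset.univ.val.map f = Finset.univ.val.map g) : f = g := by
  rw [Fin.univ_val_map, Fin.univ_val_map, Multiset.coe_eq_coe] at h
  exact List.ofFn_injective (h.eq_of_pairwise' hf.sortedGE_ofFn.pairwise hg.sortedGE_ofFn.pairwise)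

/-- Both sides are the real parts of the roots of the characteristic polynomial. Working with
multisets avoids matching the indexing of `eigenvalues` with that of `p`. -/
theorem Matrix.IsHermitian.map_eigenvalues_eq {n ι : Type*} [Fintype n] [DecidableEq n] [Fintype ι]
    {A : Matrix n n ℂ} (hA : A.IsHermitian) {p : ι → ℝ}
    (hp : A.charpoly = ∏ i, (Polynomial.X - Polynomial.C (p i : ℂ))) :
    Finset.univ.val.map hA.eigenvalues = Finset.univ.val.map p := by
  have h1 := hA.roots_charpoly_eq_eigenvalues
  have h2 : A.charpoly.roots = Multiset.map (fun i => (p i : ℂ)) Finset.univ.val := by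
    rw [hp, Polynomial.roots_prod]
    · simp
    · simp [Finset.prod_ne_zero_iff, Polynomial.X_sub_C_ne_zero]
  have h3 := congrArg (Multiset.map Complex.re) (h1.symm.trans h2)
  simpa [Multiset.map_map, Function.comp_def] using h3

theorem vonNeumannEntropy_eq_of_charpoly {n ι : Type*} [Fintype n] [DecidableEq n] [Fintype ι]
    {A : Matrix n n ℂ} (hA : A.IsHermitian) {p : ι → ℝ}
    (hp : A.charpoly = ∏ i, (Polynomial.X - Polynomial.C (p i : ℂ))) :
    vonNeumannEntropy A hA = ∑ i, Real.negMulLog (p i) := by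
  have h := congrArg (fun s => (s.map Real.negMulLog).sum) (hA.map_eigenvalues_eq hp)
  simp only [Multiset.map_map] at h
  exact h

/-- The eigenvalues of a Hermitian matrix in ascending order. -/
noncomputable def Matrix.IsHermitian.ascEigenvalues {n : ℕ} {A : Matrix (Fin n) (Fin n) ℂ}
    (hA : A.IsHermitian) : Fin n → ℝ :=
  hA.eigenvalues ∘ Tuple.sort hA.eigenvalues

theorem Matrix.IsHermitian.ascEigenvalues_monotone {n : ℕ} {A : Matrix (Fin n) (Fin n) ℂ}
    (hA : A.IsHermitian) : Monotone hA.ascEigenvalues :=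
  Tuple.monotone_sort _

theorem exists_perm_antitone {n : ℕ} (f : Fin n → ℝ) : ∃ σ : Equiv.Perm (Fin n), Antitone (f ∘ σ) :=
  ⟨Tuple.sort fun i => -f i, fun _ _ h => neg_le_neg_iff.1 (Tuple.monotone_sort (fun i => -f i) h)⟩

/-- By Birkhoff's theorem `D` is a convex combination of permutation matrices, and for each
permutation the bound is the rearrangement inequality. -/
theorem sum_le_sum_of_doublyStochastic {n : Type*} [Fintype n] [DecidableEq n] {p b : n → ℝ}
    (hpb : Antivary p b) {D : Matrix n n ℝ} (hD : D ∈ doublyStochastic ℝ n) :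
    ∑ i, p i * b i ≤ ∑ i, ∑ j, p i * D i j * b j := by
  obtain ⟨w, hw0, hw1, rfl⟩ := exists_eq_sum_perm_of_mem_doublyStochastic hD
  have key : ∀ i, ∑ j, p i * (∑ σ : Equiv.Perm n, w σ • σ.permMatrix ℝ) i j * b j
      = ∑ σ : Equiv.Perm n, w σ * (p i * b (σ i)) := by
    intro i
    simp only [Matrix.sum_apply, Matrix.smul_apply, Equiv.Perm.permMatrix, PEquiv.toMatrix_apply,
      Equiv.toPEquiv_apply, Finset.mul_sum, Finset.sum_mul]
    rw [Finset.sum_comm]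
    refine Finset.sum_congr rfl fun σ _ => ?_
    simp [Option.mem_def]
    ring
  simp only [key]
  rw [Finset.sum_comm]
  calc ∑ i, p i * b i = ∑ σ : Equiv.Perm n, w σ * ∑ i, p i * b i := by
        rw [← Finset.sum_mul, hw1, one_mul]
    _ ≤ ∑ σ : Equiv.Perm n, w σ * ∑ i, p i * b (σ i) := by
        refine Finset.sum_le_sum fun σ _ => mul_le_mul_of_nonneg_left ?_ (hw0 σ)
        exact hpb.sum_mul_le_sum_mul_comp_perm
    _ = _ := by simp only [Finset.mul_sum]

/-- The rows and columns of a unitary matrix are unit vectors. -/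
theorem normSq_unitary_mem_doublyStochastic {n : Type*} [Fintype n] [DecidableEq n]
    (U : Matrix.unitaryGroup n ℂ) :
    (Matrix.of fun i j => Complex.normSq (U.1 i j)) ∈ doublyStochastic ℝ n := by
  rw [mem_doublyStochastic_iff_sum]
  refine ⟨fun i j => Complex.normSq_nonneg _, fun i => ?_, fun j => ?_⟩
  · have h := congrFun (congrFun (Matrix.mem_unitaryGroup_iff.1 U.2) i) i
    rw [← Complex.ofReal_inj]
    simpa [Matrix.mul_apply, Complex.mul_conj, Matrix.star_apply] using h
  · have h := congrFun (congrFun (Matrix.mem_unitaryGroup_iff'.1 U.2) j) j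
    rw [← Complex.ofReal_inj]
    simpa [Matrix.mul_apply, mul_comm _ (U.1 _ _), Complex.mul_conj, Matrix.star_apply] using h

theorem Matrix.IsHermitian.eq_mul_diagonal_mul {n : Type*} [Fintype n] [DecidableEq n]
    {A : Matrix n n ℂ} (hA : A.IsHermitian) :
    A = hA.eigenvectorUnitary.1 * diagonal (fun i => (hA.eigenvalues i : ℂ)) *
      (hA.eigenvectorUnitary.1)ᴴ := by
  conv_lhs => rw [hA.spectral_theorem]
  rfl

theorem Matrix.IsHermitian.trace_mul_eq {n : Type*} [Fintype n] [DecidableEq n]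
    {A B : Matrix n n ℂ} (hA : A.IsHermitian) (hB : B.IsHermitian) :
    (A * B).trace.re = ∑ i, ∑ j, hB.eigenvalues i *
      Complex.normSq ((star hB.eigenvectorUnitary * hA.eigenvectorUnitary).1 i j) *
      hA.eigenvalues j := by
  have h : (A * B).trace = (diagonal (fun i => (hB.eigenvalues i : ℂ)) *
      ((star hB.eigenvectorUnitary * hA.eigenvectorUnitary).1 *
        diagonal (fun i => (hA.eigenvalues i : ℂ)) *
        (star hB.eigenvectorUnitary * hA.eigenvectorUnitary).1ᴴ)).trace := by
    conv_lhs => rw [hA.eq_mul_diagonal_mul, hB.eq_mul_diagonal_mul]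
    rw [Matrix.trace_mul_comm]
    simp only [Submonoid.coe_mul, Unitary.coe_star, Matrix.star_eq_conjTranspose,
      Matrix.conjTranspose_mul, Matrix.conjTranspose_conjTranspose, Matrix.mul_assoc]
    rw [Matrix.trace_mul_comm]
    simp only [Matrix.mul_assoc]
  rw [h, Matrix.trace]
  simp only [Matrix.diag_apply, Matrix.diagonal_mul, Complex.re_sum]
  refine Finset.sum_congr rfl fun i _ => ?_
  rw [Matrix.mul_apply, Complex.re_ofReal_mul, Complex.re_sum, Finset.mul_sum]
  refine Finset.sum_congr rfl fun j _ => ?_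
  rw [Matrix.mul_diagonal, Matrix.conjTranspose_apply, mul_right_comm, Complex.star_def,
    Complex.mul_conj, ← Complex.ofReal_mul, Complex.ofReal_re, mul_assoc]

/-- Von Neumann's trace inequality. -/
theorem Matrix.IsHermitian.sum_mul_ascEigenvalues_le {n : ℕ} {A B : Matrix (Fin n) (Fin n) ℂ}
    (hA : A.IsHermitian) (hB : B.IsHermitian) {p : Fin n → ℝ} (hp : Antitone p)
    (hpB : B.charpoly = ∏ i, (Polynomial.X - Polynomial.C (p i : ℂ))) :
    ∑ i, p i * hA.ascEigenvalues i ≤ (A * B).trace.re := by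
  obtain ⟨σ, hσ⟩ := exists_perm_antitone hB.eigenvalues
  set τ := Tuple.sort hA.eigenvalues with hτ
  have hpσ : p = hB.eigenvalues ∘ σ := by
    refine hp.eq_of_map_univ_eq hσ ?_
    rw [← hB.map_eigenvalues_eq hpB, ← Multiset.map_map]
    congr 1
    simp
  rw [hA.trace_mul_eq hB]
  have hD := normSq_unitary_mem_doublyStochastic (star hB.eigenvectorUnitary * hA.eigenvectorUnitary)
  -- Permuting rows by `σ` and columns by `τ` puts the two spectra in opposite orders and keeps the
  -- matrix doubly stochastic.
  have hD' : (Matrix.of fun i j => Complex.normSq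
      ((star hB.eigenvectorUnitary * hA.eigenvectorUnitary).1 (σ i) (τ j))) ∈
      doublyStochastic ℝ (Fin n) := by
    rw [mem_doublyStochastic_iff_sum] at hD ⊢
    refine ⟨fun i j => hD.1 _ _, fun i => ?_, fun j => ?_⟩
    · exact (Equiv.sum_comp τ _).trans (hD.2.1 (σ i))
    · exact (Equiv.sum_comp σ _).trans (hD.2.2 (τ j))
  have hanti : Antivary p hA.ascEigenvalues := hp.antivary hA.ascEigenvalues_monotone
  refine (sum_le_sum_of_doublyStochastic hanti hD').trans_eq (Eq.symm ?_)
  rw [← Equiv.sum_comp σ]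
  refine Finset.sum_congr rfl fun i _ => ?_
  rw [← Equiv.sum_comp τ]
  simp [hpσ, Matrix.IsHermitian.ascEigenvalues, hτ]

/-- The coefficient matrix of a vector of the bipartite system. -/
def coeffMatrix {a b : Type*} (ψ : EuclideanSpace ℂ (a × b)) : Matrix a b ℂ :=
  Matrix.of fun i k => ψ (i, k)

theorem traceB_ketBra {a b : Type*} [Fintype b] (ψ : EuclideanSpace ℂ (a × b)) :
    traceB (ketBra ψ) = coeffMatrix ψ * (coeffMatrix ψ)ᴴ := by
  ext i j
  simp [traceB, ketBra, Matrix.vecMulVec_apply, coeffMatrix, Matrix.mul_apply]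

/-! ### Norm and energy in terms of the coefficient matrix -/

section PureStates

variable {a b : Type*} [Fintype a] [Fintype b]

theorem norm_sq_eq_trace (ψ : EuclideanSpace ℂ (a × b)) :
    ((‖ψ‖ ^ 2 : ℝ) : ℂ) = (coeffMatrix ψ * (coeffMatrix ψ)ᴴ).trace := by
  rw [EuclideanSpace.norm_sq_eq, Fintype.sum_prod_type]
  simp [coeffMatrix, Matrix.trace, Matrix.mul_apply, Complex.mul_conj, Complex.normSq_eq_norm_sq]

theorem energy_localHamiltonian_ketBra [DecidableEq a] [DecidableEq b] (HA : Matrix a a ℂ)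
    (HB : Matrix b b ℂ) (ψ : EuclideanSpace ℂ (a × b)) :
    energy (localHamiltonian HA HB) (ketBra ψ) =
      (HA * (coeffMatrix ψ * (coeffMatrix ψ)ᴴ)).trace.re +
      (HB * ((coeffMatrix ψ)ᵀ * (coeffMatrix ψ)ᵀᴴ)).trace.re := by
  rw [energy, localHamiltonian, Matrix.add_mul, Matrix.trace_add, Complex.add_re]
  congr 2
  · simp only [Matrix.trace, Matrix.diag_apply, Matrix.mul_apply, Fintype.sum_prod_type,
      Matrix.kronecker, Matrix.kroneckerMap_apply, Matrix.one_apply, ketBra, Matrix.vecMulVec_apply, coeffMatrix,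
      Matrix.of_apply, Matrix.conjTranspose_apply, mul_ite, mul_one, mul_zero, ite_mul, zero_mul,
      Finset.sum_ite_eq, Finset.mem_univ, if_true, Finset.mul_sum]
    exact Finset.sum_congr rfl fun i _ => Finset.sum_comm
  · simp only [Matrix.trace, Matrix.diag_apply, Matrix.mul_apply, Fintype.sum_prod_type,
      Matrix.kronecker, Matrix.kroneckerMap_apply, Matrix.one_apply, ketBra, Matrix.vecMulVec_apply, coeffMatrix,
      Matrix.of_apply, Matrix.conjTranspose_apply, Matrix.transpose_apply, ite_mul, one_mul,
      zero_mul, Finset.mul_sum]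
    rw [Finset.sum_comm]
    refine Finset.sum_congr rfl fun k _ => ?_
    refine Eq.trans (Finset.sum_congr rfl fun i _ => ?_) Finset.sum_comm
    rw [Finset.sum_comm]
    simp

end PureStates

theorem Matrix.trace_mul_of_mul_eq_mul_diagonal {n m : Type*} [Fintype n] [DecidableEq n]
    [Fintype m] [DecidableEq m]
    {H : Matrix n n ℂ} {V : Matrix n m ℂ} {h p : m → ℝ}
    (hV : Vᴴ * V = 1) (hHV : H * V = V * diagonal (fun i => (h i : ℂ))) :
    (H * (V * diagonal (fun i => (p i : ℂ)) * Vᴴ)).trace.re = ∑ i, p i * h i := by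
  rw [← Matrix.mul_assoc, ← Matrix.mul_assoc, hHV, Matrix.mul_assoc V, Matrix.trace_mul_comm,
    ← Matrix.mul_assoc, hV, Matrix.one_mul, Matrix.diagonal_mul_diagonal, Matrix.trace_diagonal,
    Complex.re_sum]
  refine Finset.sum_congr rfl fun i _ => ?_
  rw [← Complex.ofReal_mul, Complex.ofReal_re, mul_comm]

/-- The columns of `V` are the eigenvectors for the levels selected by `f`. An isometry is needed
since `HB` may have more levels than the Schmidt decomposition has terms. -/
theorem Matrix.IsHermitian.exists_isometry {n m : ℕ} {H : Matrix (Fin n) (Fin n) ℂ}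
    (hH : H.IsHermitian) (f : Fin m ↪ Fin n) : ∃ V : Matrix (Fin n) (Fin m) ℂ,
      Vᴴ * V = 1 ∧ H * V = V * diagonal (fun i => (hH.ascEigenvalues (f i) : ℂ)) := by
  set g : Fin m → Fin n := fun i => Tuple.sort hH.eigenvalues (f i) with hg
  have hginj : Function.Injective g := (Equiv.injective _).comp f.injective
  set U := hH.eigenvectorUnitary.1 with hU
  have hUU : Uᴴ * U = 1 := Matrix.mem_unitaryGroup_iff'.1 hH.eigenvectorUnitary.2
  refine ⟨U.submatrix id g, ?_, ?_⟩
  · have : (U.submatrix id g)ᴴ * U.submatrix id g = (Uᴴ * U).submatrix g g := by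
      ext i j; simp [Matrix.mul_apply]
    rw [this, hUU, Matrix.submatrix_one _ hginj]
  · have h1 : H * U = U * diagonal (fun i => (hH.eigenvalues i : ℂ)) := by
      conv_lhs => rw [hH.eq_mul_diagonal_mul]
      rw [Matrix.mul_assoc, hUU, Matrix.mul_one]
    ext i j
    have h2 := congrFun (congrFun h1 i) (g j)
    rw [Matrix.mul_diagonal] at h2 ⊢
    simpa [Matrix.mul_apply, hg, Matrix.IsHermitian.ascEigenvalues] using h2

open Polynomial in
theorem Matrix.charpoly_mul_diagonal_mul {n : Type*} [Fintype n] [DecidableEq n]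
    {V : Matrix n n ℂ} (hV : Vᴴ * V = 1) (p : n → ℝ) :
    (V * diagonal (fun i => (p i : ℂ)) * Vᴴ).charpoly = ∏ i, (X - C (p i : ℂ)) := by
  rw [Matrix.charpoly_mul_comm, ← Matrix.mul_assoc, hV, Matrix.one_mul, Matrix.charpoly_diagonal]

/-! ### Pure states and probability vectors on the paired levels -/

section Pairing

variable {m d : ℕ} {HA : Matrix (Fin m) (Fin m) ℂ} {HB : Matrix (Fin (m + d)) (Fin (m + d)) ℂ}

/-- The energies of the pairs formed by the `i`-th lowest levels of both systems. -/
noncomputable def pairedLevels (hHA : HA.IsHermitian) (hHB : HB.IsHermitian) (i : Fin m) : ℝ :=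
  hHA.ascEigenvalues i + hHB.ascEigenvalues (Fin.castAdd d i)

theorem pairedLevels_monotone (hHA : HA.IsHermitian) (hHB : HB.IsHermitian) :
    Monotone (pairedLevels hHA hHB) := fun _ _ h =>
  add_le_add (hHA.ascEigenvalues_monotone h) (hHB.ascEigenvalues_monotone (Fin.le_def.2 (Fin.le_def.1 h)))

theorem exists_pureState_of_mem_stdSimplex (hHA : HA.IsHermitian) (hHB : HB.IsHermitian)
    {p : Fin m → ℝ} (hp : p ∈ stdSimplex ℝ (Fin m)) :
    ∃ ψ : EuclideanSpace ℂ (Fin m × Fin (m + d)), ‖ψ‖ = 1 ∧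
      entanglementEntropy ψ = ∑ i, Real.negMulLog (p i) ∧
      energy (localHamiltonian HA HB) (ketBra ψ) = ∑ i, p i * pairedLevels hHA hHB i := by
  obtain ⟨U, hU, hHU⟩ := hHA.exists_isometry (Function.Embedding.refl (Fin m))
  obtain ⟨V, hV, hHV⟩ := hHB.exists_isometry (Fin.castAddEmb d (n := m))
  set s : Matrix (Fin m) (Fin m) ℂ := diagonal (fun i => ((√(p i) : ℝ) : ℂ)) with hs
  have hss : s * s = diagonal (fun i => (p i : ℂ)) := by
    rw [hs, Matrix.diagonal_mul_diagonal]
    congr 1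
    ext i
    rw [← Complex.ofReal_mul, Real.mul_self_sqrt (hp.1 i)]
  have hsH : sᴴ = s := by
    rw [hs, Matrix.diagonal_conjTranspose]
    congr 1
    ext i
    simp
  have hsT : sᵀ = s := by rw [hs, Matrix.diagonal_transpose]
  -- This is `∑ √(p i) uᵢ ⊗ vᵢ` for the columns `uᵢ` of `U` and `vᵢ` of `V`; the tensor product is
  -- bilinear, hence `Vᵀ` and not `Vᴴ`.
  let ψ : EuclideanSpace ℂ (Fin m × Fin (m + d)) :=
    WithLp.toLp 2 fun x => (U * s * Vᵀ) x.1 x.2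
  have hM : coeffMatrix ψ = U * s * Vᵀ := rfl
  have hVT : Vᵀ * Vᵀᴴ = 1 := by
    have := congrArg Matrix.transpose hV
    rwa [Matrix.transpose_mul, Matrix.transpose_one] at this
  have hUT : Uᵀ * Uᵀᴴ = 1 := by
    have := congrArg Matrix.transpose hU
    rwa [Matrix.transpose_mul, Matrix.transpose_one] at this
  have hMA : coeffMatrix ψ * (coeffMatrix ψ)ᴴ = U * diagonal (fun i => (p i : ℂ)) * Uᴴ := by
    rw [hM, Matrix.conjTranspose_mul, Matrix.conjTranspose_mul, hsH, ← hss]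
    calc U * s * Vᵀ * (Vᵀᴴ * (s * Uᴴ)) = U * s * (Vᵀ * Vᵀᴴ) * (s * Uᴴ) := by
          simp only [Matrix.mul_assoc]
      _ = _ := by rw [hVT]; simp only [Matrix.mul_assoc, Matrix.one_mul]
  have hMB : (coeffMatrix ψ)ᵀ * (coeffMatrix ψ)ᵀᴴ = V * diagonal (fun i => (p i : ℂ)) * Vᴴ := by
    rw [hM, Matrix.transpose_mul, Matrix.transpose_mul, Matrix.conjTranspose_mul,
      Matrix.conjTranspose_mul, hsT, hsH, ← hss, Matrix.transpose_transpose]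
    calc V * (s * Uᵀ) * (Uᵀᴴ * s * Vᴴ) = V * s * (Uᵀ * Uᵀᴴ) * (s * Vᴴ) := by
          simp only [Matrix.mul_assoc]
      _ = _ := by rw [hUT]; simp only [Matrix.mul_assoc, Matrix.one_mul]
  refine ⟨ψ, ?_, ?_, ?_⟩
  · have h := norm_sq_eq_trace ψ
    rw [hMA, Matrix.mul_assoc, Matrix.trace_mul_comm, Matrix.mul_assoc, hU, Matrix.mul_one,
      Matrix.trace_diagonal, ← Complex.ofReal_sum, hp.2, Complex.ofReal_inj] at h
    exact (pow_eq_one_iff_of_nonneg (norm_nonneg _) two_ne_zero).1 h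
  · refine vonNeumannEntropy_eq_of_charpoly _ ?_
    rw [traceB_ketBra, hMA, Matrix.charpoly_mul_diagonal_mul hU]
  · rw [energy_localHamiltonian_ketBra, hMA, hMB, Matrix.trace_mul_of_mul_eq_mul_diagonal hU hHU,
      Matrix.trace_mul_of_mul_eq_mul_diagonal hV hHV, ← Finset.sum_add_distrib]
    exact Finset.sum_congr rfl fun i _ => (mul_add _ _ _).symm

theorem exists_mem_stdSimplex_of_pureState (hHA : HA.IsHermitian) (hHB : HB.IsHermitian)
    {ψ : EuclideanSpace ℂ (Fin m × Fin (m + d))} (hψ : ‖ψ‖ = 1) :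
    ∃ p ∈ stdSimplex ℝ (Fin m), ∑ i, Real.negMulLog (p i) = entanglementEntropy ψ ∧
      ∑ i, p i * pairedLevels hHA hHB i ≤ energy (localHamiltonian HA HB) (ketBra ψ) := by
  set M := coeffMatrix ψ with hM
  have hA : (M * Mᴴ).IsHermitian := Matrix.isHermitian_mul_conjTranspose_self M
  have hB : (Mᵀ * Mᵀᴴ).IsHermitian := Matrix.isHermitian_mul_conjTranspose_self Mᵀ
  obtain ⟨σ, hσ⟩ := exists_perm_antitone hA.eigenvalues
  set p := hA.eigenvalues ∘ σ with hp
  have hp0 : ∀ i, 0 ≤ p i := fun i =>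
    (Matrix.posSemidef_self_mul_conjTranspose M).eigenvalues_nonneg (σ i)
  have hp1 : ∑ i, p i = 1 := by
    have h1 := (norm_sq_eq_trace ψ).trans hA.trace_eq_sum_eigenvalues
    rw [hψ] at h1
    have h2 : ∑ i, hA.eigenvalues i = 1 := by
      rw [← Complex.ofReal_inj]
      push_cast
      simpa using h1.symm
    rw [← h2]
    exact Equiv.sum_comp σ hA.eigenvalues
  have hcA : (M * Mᴴ).charpoly = ∏ i, (Polynomial.X - Polynomial.C (p i : ℂ)) := by
    rw [hA.charpoly_eq]
    exact (Equiv.prod_comp σ _).symm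
  -- The reduced state on `B` has the same spectrum with `d` further zeros; since `p ≥ 0`, appending
  -- them at the end keeps the order descending.
  set q : Fin (m + d) → ℝ := Fin.append p (fun _ => 0) with hq
  have hq_anti : Antitone q := by
    intro i j hij
    induction j using Fin.addCases with
    | left j =>
      induction i using Fin.addCases with
      | left i => simpa [hq] using! hσ (Fin.le_def.2 (Fin.le_def.1 hij))
      | right i =>
        have h := Fin.le_def.1 hij
        simp at h
        omega
    | right j =>
      induction i using Fin.addCases with
      | left i => simpa [hq] using hp0 i
      | right i => simp [hq]
  have hcB : (Mᵀ * Mᵀᴴ).charpoly = ∏ i, (Polynomial.X - Polynomial.C (q i : ℂ)) := by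
    have h1 : (Mᵀ * Mᵀᴴ).charpoly = (Mᴴ * M).charpoly := by
      rw [← Matrix.charpoly_transpose, Matrix.transpose_mul, Matrix.transpose_transpose]
      rfl
    -- Swapping the rectangular factors multiplies the characteristic polynomial by `X ^ d`, which
    -- accounts for the appended zeros.
    rw [h1, Matrix.charpoly_mul_comm_of_le _ _ (by simp), hcA, Fin.prod_univ_add]
    simp [hq, mul_comm]
  refine ⟨p, ⟨hp0, hp1⟩, ?_, ?_⟩
  · refine (vonNeumannEntropy_eq_of_charpoly _ ?_).symm
    rw [traceB_ketBra, hcA]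
  · rw [energy_localHamiltonian_ketBra]
    refine le_trans (le_of_eq ?_) (add_le_add (hHA.sum_mul_ascEigenvalues_le hA hσ hcA)
      (hHB.sum_mul_ascEigenvalues_le hB hq_anti hcB))
    rw [Fin.sum_univ_add]
    simp [hq, pairedLevels, mul_add, Finset.sum_add_distrib]

end Pairing

/-! ### Entropy on the simplex -/

theorem sum_negMulLog_le_log_card {n : ℕ} {p : Fin n → ℝ} (hp : p ∈ stdSimplex ℝ (Fin n)) :
    ∑ i, Real.negMulLog (p i) ≤ Real.log n := by
  rcases Nat.eq_zero_or_pos n with rfl | hn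
  · simp
  have hn' : (0 : ℝ) < n := by exact_mod_cast hn
  -- Jensen's inequality with uniform weights: the mean of `p` is `1 / n`.
  have h := Real.concaveOn_negMulLog.le_map_sum (t := Finset.univ) (w := fun _ : Fin n => (n : ℝ)⁻¹)
    (p := p) (fun _ _ => by positivity) (by simp [hn'.ne']) (fun i _ => hp.1 i)
  simp only [smul_eq_mul, ← Finset.mul_sum, hp.2, mul_one] at h
  rw [Real.negMulLog, Real.log_inv, neg_mul_neg] at h
  exact le_of_mul_le_mul_left h (inv_pos.2 hn')

/-- On the segment from `q` to the vertex at the lowest level, the entropy varies continuously from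
at least `ε` to `0`, so it takes the value `ε`; the energy is affine there and is least at the
vertex. -/
theorem exists_entropy_eq_of_le {n : ℕ} {e : Fin n → ℝ} (he : Monotone e) {q : Fin n → ℝ}
    (hq : q ∈ stdSimplex ℝ (Fin n)) {ε : ℝ} (h0 : 0 ≤ ε) (hε : ε ≤ ∑ i, Real.negMulLog (q i)) :
    ∃ p ∈ stdSimplex ℝ (Fin n), ∑ i, Real.negMulLog (p i) = ε ∧
      ∑ i, p i * e i ≤ ∑ i, q i * e i := by
  rcases n with _ | n
  · simp [stdSimplex] at hq
  set δ : Fin (n + 1) → ℝ := Pi.single 0 1 with hδ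
  have hδs : δ ∈ stdSimplex ℝ (Fin (n + 1)) := single_mem_stdSimplex ℝ 0
  let γ : ℝ → Fin (n + 1) → ℝ := fun t => (1 - t) • q + t • δ
  have hcont : Continuous fun t => ∑ i, Real.negMulLog (γ t i) := by
    refine continuous_finsetSum _ fun i _ => Real.continuous_negMulLog.comp ?_
    simp only [γ, Pi.add_apply, Pi.smul_apply, smul_eq_mul]
    fun_prop
  have hδ0 : ∑ i, Real.negMulLog (δ i) = 0 := by
    refine Finset.sum_eq_zero fun i _ => ?_
    rcases eq_or_ne i 0 with rfl | hi
    · simp [hδ]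
    · simp [hδ, hi]
  obtain ⟨t, ht, hte⟩ := intermediate_value_Icc' zero_le_one hcont.continuousOn
    (show ε ∈ Set.Icc _ _ by simpa [γ, hδ0] using ⟨h0, hε⟩)
  refine ⟨γ t, convex_stdSimplex ℝ _ hq hδs (sub_nonneg.2 ht.2) ht.1 (by ring), hte, ?_⟩
  have hmin : e 0 ≤ ∑ i, q i * e i := by
    calc e 0 = ∑ i, q i * e 0 := by rw [← Finset.sum_mul, hq.2, one_mul]
      _ ≤ _ := Finset.sum_le_sum fun i _ =>
        mul_le_mul_of_nonneg_left (he (Fin.zero_le i)) (hq.1 i)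
  have hδe : ∑ i, δ i * e i = e 0 := by simp [hδ, Pi.single_apply]
  have hγ : ∑ i, γ t i * e i = (1 - t) * ∑ i, q i * e i + t * ∑ i, δ i * e i := by
    simp only [γ, Pi.add_apply, Pi.smul_apply, smul_eq_mul, Finset.mul_sum,
      ← Finset.sum_add_distrib]
    exact Finset.sum_congr rfl fun i _ => by ring
  rw [hγ, hδe]
  nlinarith [mul_le_mul_of_nonneg_left hmin ht.1]

/-! ### Spectral decomposition of states and the sign change of `H` -/

theorem isDensityMatrix_ketBra {n : Type*} [Fintype n] {ψ : EuclideanSpace ℂ n} (hψ : ‖ψ‖ = 1) :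
    IsDensityMatrix (ketBra ψ) := by
  refine ⟨Matrix.posSemidef_vecMulVec_self_star _, ?_⟩
  have h := EuclideanSpace.norm_sq_eq ψ
  rw [hψ, one_pow, ← Complex.ofReal_inj] at h
  simpa [ketBra, Matrix.trace, Matrix.vecMulVec_apply, Complex.mul_conj,
    Complex.normSq_eq_norm_sq] using h.symm

theorem Matrix.IsHermitian.eq_sum_smul_ketBra {n : Type*} [Fintype n] [DecidableEq n]
    {A : Matrix n n ℂ} (hA : A.IsHermitian) :
    A = ∑ i, hA.eigenvalues i • ketBra (hA.eigenvectorBasis i) := by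
  conv_lhs => rw [hA.eq_mul_diagonal_mul]
  ext i j
  rw [Matrix.mul_apply, Matrix.sum_apply]
  refine Finset.sum_congr rfl fun k _ => ?_
  rw [Matrix.mul_diagonal, Matrix.smul_apply, ketBra, Matrix.vecMulVec_apply,
    Matrix.conjTranspose_apply, Complex.real_smul]
  simp only [Matrix.IsHermitian.eigenvectorUnitary_apply]
  ring

theorem energy_sum_smul {n ι : Type*} [Fintype n] [Fintype ι] (H : Matrix n n ℂ) (w : ι → ℝ)
    (ρ : ι → Matrix n n ℂ) : energy H (∑ i, w i • ρ i) = ∑ i, w i * energy H (ρ i) := by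
  simp [energy, Matrix.mul_sum, Matrix.trace_sum]

theorem energy_neg {n : Type*} [Fintype n] (H ρ : Matrix n n ℂ) :
    energy (-H) ρ = -energy H ρ := by
  simp [energy]

theorem localHamiltonian_neg {a b : Type*} [DecidableEq a] [DecidableEq b]
    (HA : Matrix a a ℂ) (HB : Matrix b b ℂ) :
    localHamiltonian (-HA) (-HB) = -localHamiltonian HA HB := by
  ext i j
  simp [localHamiltonian, Matrix.kronecker, Matrix.kroneckerMap_apply]
  ring

theorem pureEnergies_neg {a b : Type*} [Fintype a] [DecidableEq a] [Fintype b] [DecidableEq b]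
    (HA : Matrix a a ℂ) (HB : Matrix b b ℂ) (ε x : ℝ) :
    x ∈ pureEnergies (-HA) (-HB) ε ↔ -x ∈ pureEnergies HA HB ε := by
  simp only [pureEnergies, Set.mem_ofPred_eq, localHamiltonian_neg, energy_neg, neg_eq_iff_eq_neg]

/-! ### Mixed states -/

section Main

variable {m d : ℕ} {𝓔 : Matrix (Fin m × Fin (m + d)) (Fin m × Fin (m + d)) ℂ → ℝ}
  {ρ : Matrix (Fin m × Fin (m + d)) (Fin m × Fin (m + d)) ℂ}

/-- The witness `q` is the average, weighted by the eigenvalues of `ρ`, of the Schmidt vectors of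
its eigenvectors. -/
theorem IsConvexEntanglementMeasure.exists_mem_stdSimplex (h𝓔 : IsConvexEntanglementMeasure 𝓔)
    (hρ : IsDensityMatrix ρ) {HA : Matrix (Fin m) (Fin m) ℂ} (hHA : HA.IsHermitian)
    {HB : Matrix (Fin (m + d)) (Fin (m + d)) ℂ} (hHB : HB.IsHermitian) :
    ∃ q ∈ stdSimplex ℝ (Fin m), 𝓔 ρ ≤ ∑ i, Real.negMulLog (q i) ∧
      ∑ i, q i * pairedLevels hHA hHB i ≤ energy (localHamiltonian HA HB) ρ := by
  have hH := hρ.1.isHermitian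
  set w := hH.eigenvalues with hw
  have hw0 : ∀ x, 0 ≤ w x := hρ.1.eigenvalues_nonneg
  have hw1 : ∑ x, w x = 1 := by
    have h := hH.trace_eq_sum_eigenvalues.symm.trans hρ.2
    rw [← Complex.ofReal_inj]
    push_cast
    exact h
  have hψ : ∀ x, ‖hH.eigenvectorBasis x‖ = 1 := fun x => hH.eigenvectorBasis.orthonormal.1 x
  choose p hp hpS hpE using fun x => exists_mem_stdSimplex_of_pureState hHA hHB (hψ x)
  have hdec : ρ = ∑ x, w x • ketBra (hH.eigenvectorBasis x) := hH.eq_sum_smul_ketBra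
  refine ⟨∑ x, w x • p x, (convex_stdSimplex ℝ _).sum_mem (fun x _ => hw0 x) hw1
    fun x _ => hp x, ?_, ?_⟩
  · calc 𝓔 ρ = 𝓔 (∑ x, w x • ketBra (hH.eigenvectorBasis x)) := congrArg 𝓔 hdec
      _ ≤ ∑ x, w x • 𝓔 (ketBra (hH.eigenvectorBasis x)) :=
        h𝓔.convex.map_sum_le (fun x _ => hw0 x) hw1 fun x _ => isDensityMatrix_ketBra (hψ x)
      _ = ∑ x, w x * ∑ i, Real.negMulLog (p x i) :=
        Finset.sum_congr rfl fun x _ => by rw [h𝓔.pure_eq _ (hψ x), hpS, smul_eq_mul]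
      _ = ∑ i, ∑ x, w x • Real.negMulLog (p x i) := by
        simp only [Finset.mul_sum, smul_eq_mul]
        exact Finset.sum_comm
      _ ≤ ∑ i, Real.negMulLog (∑ x, w x • p x i) := Finset.sum_le_sum fun i _ =>
        Real.concaveOn_negMulLog.le_map_sum (fun x _ => hw0 x) hw1 fun x _ => (hp x).1 i
      _ = _ := by simp [Finset.sum_apply]
  · calc ∑ i, (∑ x, w x • p x) i * pairedLevels hHA hHB i
        = ∑ x, w x * ∑ i, p x i * pairedLevels hHA hHB i := by
          simp only [Finset.sum_apply, Pi.smul_apply, smul_eq_mul, Finset.sum_mul, Finset.mul_sum,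
            mul_assoc]
          exact Finset.sum_comm
      _ ≤ ∑ x, w x * energy (localHamiltonian HA HB) (ketBra (hH.eigenvectorBasis x)) :=
        Finset.sum_le_sum fun x _ => mul_le_mul_of_nonneg_left (hpE x) (hw0 x)
      _ = energy (localHamiltonian HA HB) ρ := by
        rw [← energy_sum_smul]
        exact congrArg _ hdec.symm

theorem IsConvexEntanglementMeasure.exists_isLeast_pureEnergies
    (h𝓔 : IsConvexEntanglementMeasure 𝓔) (hρ : IsDensityMatrix ρ)
    {HA : Matrix (Fin m) (Fin m) ℂ} (hHA : HA.IsHermitian)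
    {HB : Matrix (Fin (m + d)) (Fin (m + d)) ℂ} (hHB : HB.IsHermitian) :
    ∃ x, IsLeast (pureEnergies HA HB (𝓔 ρ)) x ∧ x ≤ energy (localHamiltonian HA HB) ρ := by
  obtain ⟨q, hq, hqS, hqE⟩ := h𝓔.exists_mem_stdSimplex hρ hHA hHB
  obtain ⟨p, hp, hpS, hpE⟩ := exists_entropy_eq_of_le (pairedLevels_monotone hHA hHB) hq
    (h𝓔.nonneg ρ hρ) hqS
  have hS : Continuous fun r : Fin m → ℝ => ∑ i, Real.negMulLog (r i) := by fun_prop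
  have hE : Continuous fun r : Fin m → ℝ => ∑ i, r i * pairedLevels hHA hHB i := by fun_prop
  -- Pure-state energies are minimized through this compact slice of the simplex, which `p` shows to
  -- be nonempty. A minimizer is realized by a pure state, and every competing pure state dominates
  -- some point of the slice.
  have hK : IsCompact (stdSimplex ℝ (Fin m) ∩ {r | ∑ i, Real.negMulLog (r i) = 𝓔 ρ}) :=
    (isCompact_stdSimplex ℝ (Fin m)).inter_right (isClosed_eq hS continuous_const)
  obtain ⟨r, ⟨hr, hrS⟩, hmin⟩ := hK.exists_isMinOn ⟨p, hp, hpS⟩ hE.continuousOn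
  refine ⟨∑ i, r i * pairedLevels hHA hHB i, ⟨?_, ?_⟩, (hmin ⟨hp, hpS⟩).trans (hpE.trans hqE)⟩
  · obtain ⟨ψ, hψ, hψS, hψE⟩ := exists_pureState_of_mem_stdSimplex hHA hHB hr
    exact ⟨ψ, hψ, hψS.trans hrS, hψE⟩
  · rintro _ ⟨ψ, hψ, hψS, rfl⟩
    obtain ⟨s, hs, hsS, hsE⟩ := exists_mem_stdSimplex_of_pureState hHA hHB hψ
    exact (hmin ⟨hs, hsS.trans hψS⟩).trans hsE

end Main

theorem mainTheorem4 {NA NB : ℕ} (hN : NA ≤ NB)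
    (HA : Matrix (Fin NA) (Fin NA) ℂ) (hHA : HA.IsHermitian)
    (HB : Matrix (Fin NB) (Fin NB) ℂ) (hHB : HB.IsHermitian)
    (𝓔 : Matrix (Fin NA × Fin NB) (Fin NA × Fin NB) ℂ → ℝ)
    (h𝓔 : IsConvexEntanglementMeasure 𝓔)
    (ρ : Matrix (Fin NA × Fin NB) (Fin NA × Fin NB) ℂ) (hρ : IsDensityMatrix ρ) :
    𝓔 ρ ∈ Set.Icc 0 (Real.log NA) ∧
    IsLeast (pureEnergies HA HB (𝓔 ρ)) (Emin HA HB (𝓔 ρ)) ∧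
    IsGreatest (pureEnergies HA HB (𝓔 ρ)) (Emax HA HB (𝓔 ρ)) ∧
    Emin HA HB (𝓔 ρ) ≤ energy (localHamiltonian HA HB) ρ ∧
    energy (localHamiltonian HA HB) ρ ≤ Emax HA HB (𝓔 ρ) := by
  obtain ⟨d, rfl⟩ := Nat.exists_eq_add_of_le hN
  obtain ⟨q, hq, hqS, -⟩ := h𝓔.exists_mem_stdSimplex hρ hHA hHB
  obtain ⟨x, hx, hxE⟩ := h𝓔.exists_isLeast_pureEnergies hρ hHA hHB
  obtain ⟨y, hy, hyE⟩ := h𝓔.exists_isLeast_pureEnergies hρ hHA.neg hHB.neg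
  -- The least energy `y` for `-H` is the negative of the greatest energy for `H`.
  have hz : IsGreatest (pureEnergies HA HB (𝓔 ρ)) (-y) :=
    ⟨(pureEnergies_neg HA HB _ _).1 hy.1, fun z hz => le_neg_of_le_neg
      (hy.2 ((pureEnergies_neg HA HB _ _).2 (by rwa [neg_neg])))⟩
  rw [localHamiltonian_neg, energy_neg] at hyE
  rw [Emin, Emax, hx.csInf_eq, hz.csSup_eq]
  exact ⟨⟨h𝓔.nonneg ρ hρ, hqS.trans (sum_negMulLog_le_log_card hq)⟩, hx, hz, hxE,
    le_neg_of_le_neg hyE⟩
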